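/- Let $\mathbb{T}=\mathbb{R}/2\pi\mathbb{Z}$ with Lebesgue measure $dx$ (total mass $2\pi$) and the arc-length distance $d$. For continuous $f:\mathbb{T}\to\mathbb{R}$ let $\overline f=\frac1{2\pi}\int_{\mathbb T} f\,dx$ be its mean value, $\widehat f(k)=\frac1{2\pi}\int_{\mathbb{T}}f(x)e^{-ikx}\,dx$ its Fourier coefficients, and $$\|f\|_{\dot H^{-1}}:=\Big(\sum_{k=1}^\infty\frac{|\widehat f(k)|^2}{k^2}\Big)^{1/2}.$$ For finite measures $\mu,\nu$ on $\mathbb{T}$ of equal mass let $W_1(\mu,\nu)=\inf_{\gamma}\int_{\mathbb{T}\times\mathbb{T}} d(x,y)\,d\gamma(x,y)$, where $\gamma$ ranges over all measures on $\mathbb{T}\times\mathbb{T}$ with marginals $\mu$ and $\nu$. Numbers of solutions may be infinite; we use $\infty\cdot 0=0$, and $0/0=0$ when $f\equiv0$. There are absolute constants $c_1,c_2>0$ and $C_1,C_2<\infty$ such that the following hold. (i) (Uncertainty principle) For every continuous $f:\mathbb{T}\to\mathbb{R}$ with mean value $0$, $$\#\{x\in\mathbb{T}:f(x)=0\}\cdot\Big(\sum_{k=1}^\infty\frac{|\widehat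 f(k)|^2}{k^2}\Big)^{1/2}\ \ge\ c_1\,\frac{\|f\|_{L^1(\mathbb{T})}^2}{\|f\|_{L^\infty(\mathbb{T})}}.$$ (ii) (Sharpness up to constants) For every integer $n\ge1$ the function $f(x)=\sin(nx)$, which is continuous, not identically zero and of mean value $0$, satisfies the reverse inequality $$\#\{x\in\mathbb{T}:f(x)=0\}\cdot\Big(\sum_{k=1}^\infty\frac{|\widehat f(k)|^2}{k^2}\Big)^{1/2}\ \le\ C_1\,\frac{\|f\|_{L^1(\mathbb{T})}^2}{\|f\|_{L^\infty(\mathbb{T})}}.$$ (iii) (Stronger inequality) For every continuous $f:\mathbb{T}\to[0,\infty)$, $$\#\{x\in\mathbb{T}:f(x)=\overline f\}\cdot W_1\big(f(x)\,dx,\overline f\,dx\big)\ \ge\ c_2\,\frac{\|f-\overline f\|_{L^1(\mathbb{T})}^2}{\|f\|_{L^\infty(\mathbb{T})}}.$$ (iv) For every continuous $f:\mathbb{T}\to[0,\infty)$, $$W_1\big(f(x)\,dx,\overline f\,dx\big)\ \le\ C_2\,\|f\|_{\dot H^{-1}}.$$ -/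

import Mathlib

open Real MeasureTheory
open scoped ENNReal NNReal

/-- The one-dimensional torus `ℝ / 2πℤ`, with its arc-length distance and Lebesgue measure
(of total mass `2π`). -/
abbrev Torus : Type := AddCircle (2 * π)

instance fact_two_pi_pos : Fact (0 < 2 * π) := ⟨Real.two_pi_pos⟩

/-- The set `Γ(μ, ν)` of couplings of `μ` and `ν`: measures on the product with marginals
`μ` and `ν`. -/
def couplings {X : Type*} [MeasurableSpace X] (μ ν : Measure X) : Set (Measure (X × X)) :=
  {γ | γ.map Prod.fst = μ ∧ γ.map Prod.snd = ν}

/-- The `p`-Wasserstein distance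
`W_p(μ, ν) = (inf_{γ ∈ Γ(μ, ν)} ∫ d(x, y)^p dγ(x, y))^{1/p}`, with values in `[0, ∞]`. -/
noncomputable def wasserstein {X : Type*} [MeasurableSpace X] [PseudoEMetricSpace X]
    (p : ℝ) (μ ν : Measure X) : ℝ≥0∞ :=
  (⨅ γ ∈ couplings μ ν, ∫⁻ z, edist z.1 z.2 ^ p ∂γ) ^ (1 / p)

/-- The measure `f(x) dx` on the torus, for a nonnegative density `f`. -/
noncomputable def densityMeasure (f : Torus → ℝ) : Measure Torus :=
  volume.withDensity fun x => ENNReal.ofReal (f x)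

/-- The mean value `(2π)⁻¹ ∫ f(x) dx` of a function on the torus. -/
noncomputable def meanValue (f : Torus → ℝ) : ℝ := ⨍ x, f x

/-- The quantity `(∑_{k ≥ 1} |f̂(k)|² / k²)^{1/2}`, with values in `[0, ∞]`, where
`f̂(k) = (2π)⁻¹ ∫ f(x) e^{-ikx} dx`. -/
noncomputable def negSobolevNorm (f : Torus → ℝ) : ℝ≥0∞ :=
  (∑' k : ℕ+, ‖fourierCoeff (fun x : Torus => (f x : ℂ)) ((k : ℕ) : ℤ)‖ₑ ^ 2
    / ((k : ℕ) : ℝ≥0∞) ^ 2) ^ (1 / 2 : ℝ)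

/-- The number of solutions `x` in the torus of `f x = a`, possibly infinite. -/
noncomputable def numSolutions (f : Torus → ℝ) (a : ℝ) : ℝ≥0∞ :=
  ({x : Torus | f x = a}.encard : ℝ≥0∞)

theorem sin_nat_mul_periodic (n : ℕ) :
    Function.Periodic (fun x : ℝ => Real.sin (n * x)) (2 * π) := by
  intro x
  have h : (n : ℝ) * (x + 2 * π) = n * x + n * (2 * π) := by ring
  simp only [h, Real.sin_add_nat_mul_two_pi]

/-- The function `x ↦ sin(nx)` on the torus. -/
noncomputable def sinWave (n : ℕ) : Torus → ℝ := (sin_nat_mul_periodic n).lift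

/-! Write `m` for the mean of `f`, `g = f - m` and `Z` for the zero set of `g`. Lower bound on `W₁`:
the distance to `Z`, with the sign of `g`, is 1-Lipschitz, because a shortest arc between points of
opposite sign meets `Z`. Testing a coupling against it gives `∫ |g| d(·, Z) ≤ W₁`
(`ofReal_integral_abs_mul_infDist_le_wasserstein`). If `Z` has `N` points, its `t`-neighbourhood has
measure at most `2Nt`, so bounded `g` cannot concentrate there (`Torus.sq_integral_abs_le`).

Upper bound: let `F` be the mean-zero primitive of `g`. The map `x ↦ x + F(x)/m` carries `f dx` to
`m dx` at cost at most `∫ |F|` (`wasserstein_le_integral_abs_primitive`), which Cauchy–Schwarz and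
Parseval bound by the negative Sobolev norm.

Applied to `f + ‖f‖_∞`, the two bounds give the uncertainty principle: the shift affects neither the
zero count nor the coefficients with `k ≠ 0`, and at most doubles the sup norm. Sharpness for
`sin(nx)` is a direct computation. -/

theorem Torus.exists_zero_between {g : Torus → ℝ} (hg : Continuous g) {x y : Torus}
    (hxy : g x * g y ≤ 0) : ∃ z, g z = 0 ∧ dist x z + dist z y ≤ dist x y := by
  obtain ⟨a, rfl⟩ := QuotientAddGroup.mk_surjective x
  -- The representative of `y - a` in `(-π, π]` makes `s ↦ a + s * r` a shortest arc.
  obtain ⟨r, hr, hrn⟩ : ∃ r : ℝ, (r : Torus) = y - (a : Torus) ∧ |r| = ‖y - (a : Torus)‖ := by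
    refine ⟨(AddCircle.equivIoc (2 * π) (-π) (y - a) : ℝ), AddCircle.coe_equivIoc, ?_⟩
    have hm := (AddCircle.equivIoc (2 * π) (-π) (y - (a : Torus))).2
    nth_rw 2 [← AddCircle.coe_equivIoc (p := 2 * π) (a := -π) (y := y - (a : Torus))]
    refine ((AddCircle.norm_coe_eq_abs_iff _ two_pi_pos.ne').2 ?_).symm
    rw [abs_of_pos two_pi_pos, abs_le]
    constructor <;> linarith [hm.1, hm.2]
  have hy : y = ((a + r : ℝ) : Torus) := by
    rw [AddCircle.coe_add, hr]; abel
  have hd : dist (a : Torus) y = |r| := by rw [hrn, dist_eq_norm, norm_sub_rev]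
  have hc : Continuous fun s : ℝ => g ((a + s * r : ℝ) : Torus) :=
    hg.comp ((AddCircle.continuous_mk' _).comp (by fun_prop))
  obtain ⟨s, hs, hgs⟩ : ∃ s ∈ Set.Icc (0 : ℝ) 1, g ((a + s * r : ℝ) : Torus) = 0 := by
    have h0 : g ((a + 0 * r : ℝ) : Torus) = g (a : Torus) := by simp
    have h1 : g ((a + 1 * r : ℝ) : Torus) = g y := by rw [hy]; simp
    rcases le_total (g (a : Torus)) 0 with h | h
    · rcases h.lt_or_eq with h' | h'
      · exact intermediate_value_Icc zero_le_one hc.continuousOn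
          ⟨by simpa only [h0] using h, by
            simp only [h1]; by_contra hn; push Not at hn
            have := mul_pos_of_neg_of_neg h' hn
            exact absurd hxy (not_le.2 this)⟩
      · exact ⟨0, by simp, by rw [h0, h']⟩
    · rcases h.lt_or_eq with h' | h'
      · exact intermediate_value_Icc' zero_le_one hc.continuousOn
          ⟨by
            simp only [h1]; by_contra hn; push Not at hn
            exact absurd hxy (not_le.2 (mul_pos h' hn)), by simpa only [h0] using h⟩
      · exact ⟨0, by simp, by rw [h0, ← h']⟩
  have hle : ∀ u v : ℝ, dist (u : Torus) (v : Torus) ≤ |u - v| := fun u v => by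
    rw [dist_eq_norm, ← AddCircle.coe_sub]
    exact QuotientAddGroup.norm_mk_le_norm
  refine ⟨_, hgs, ?_⟩
  change dist (a : Torus) _ + _ ≤ dist (a : Torus) y
  rw [hd]
  calc dist (a : Torus) ((a + s * r : ℝ) : Torus) + dist ((a + s * r : ℝ) : Torus) y
      ≤ |a - (a + s * r)| + |a + s * r - (a + r)| := add_le_add (hle _ _) (by rw [hy]; exact hle _ _)
    _ = s * |r| + (1 - s) * |r| := by
      rw [show a - (a + s * r) = -(s * r) by ring, abs_neg, abs_mul, abs_of_nonneg hs.1,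
        show a + s * r - (a + r) = -((1 - s) * r) by ring, abs_neg, abs_mul,
        abs_of_nonneg (sub_nonneg.2 hs.2)]
    _ = |r| := by ring

/-- The distance to the zero set of `g`, with the sign of `g`. -/
noncomputable def signedZeroDist (g : Torus → ℝ) (x : Torus) : ℝ :=
  SignType.sign (g x) * Metric.infDist x {z | g z = 0}

theorem mul_signedZeroDist (g : Torus → ℝ) (x : Torus) :
    g x * signedZeroDist g x = |g x| * Metric.infDist x {z | g z = 0} := by
  rw [signedZeroDist, ← mul_assoc, mul_comm (g x), sign_mul_self]

/-- For equal signs this is the Lipschitz bound for `infDist`. Otherwise a zero on a shortest arc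
from `x` to `y` bounds the sum of the two distances by `dist x y`. -/
theorem abs_signedZeroDist_sub_le {g : Torus → ℝ} (hg : Continuous g) (x y : Torus) :
    |signedZeroDist g x - signedZeroDist g y| ≤ dist x y := by
  have key : g x * g y ≤ 0 →
      Metric.infDist x {z | g z = 0} + Metric.infDist y {z | g z = 0} ≤ dist x y := fun h => by
    obtain ⟨z, hz, hle⟩ := Torus.exists_zero_between hg h
    have h1 := Metric.infDist_le_dist_of_mem (x := x) (s := {z | g z = 0}) hz
    have h2 := Metric.infDist_le_dist_of_mem (x := y) (s := {z | g z = 0}) hz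
    rw [dist_comm] at h2
    linarith
  have hx0 := Metric.infDist_nonneg (x := x) (s := {z | g z = 0})
  have hy0 := Metric.infDist_nonneg (x := y) (s := {z | g z = 0})
  have h1 := Metric.infDist_le_infDist_add_dist (x := x) (y := y) (s := {z | g z = 0})
  have h2 := Metric.infDist_le_infDist_add_dist (x := y) (y := x) (s := {z | g z = 0})
  rw [dist_comm y x] at h2
  unfold signedZeroDist
  rw [abs_le]
  rcases lt_trichotomy (g x) 0 with hx | hx | hx <;> rcases lt_trichotomy (g y) 0 with hy | hy | hy
  all_goals
    simp only [hx, hy, _root_.sign_neg, sign_pos, _root_.sign_zero, SignType.coe_neg_one, SignType.coe_one,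
      SignType.coe_zero] at key ⊢
    try have := key (by nlinarith)
    constructor <;> linarith

theorem lipschitzWith_signedZeroDist {g : Torus → ℝ} (hg : Continuous g) :
    LipschitzWith 1 (signedZeroDist g) :=
  LipschitzWith.of_dist_le_mul fun x y => by
    simpa [Real.dist_eq] using abs_signedZeroDist_sub_le hg x y

/-! ### Kantorovich duality and non-concentration near finite sets -/

/-- The easy half of Kantorovich duality. -/
theorem ofReal_integral_sub_le_wasserstein {X : Type*} [PseudoMetricSpace X] [CompactSpace X]
    [SecondCountableTopology X]
    [MeasurableSpace X] [BorelSpace X] {μ ν : Measure X} [IsFiniteMeasure μ] [IsFiniteMeasure ν]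
    {φ : X → ℝ} (hφ : LipschitzWith 1 φ) :
    ENNReal.ofReal (∫ x, φ x ∂μ - ∫ x, φ x ∂ν) ≤ wasserstein 1 μ ν := by
  unfold wasserstein
  simp only [ENNReal.rpow_one, div_one]
  refine le_iInf₂ fun γ hγ => ?_
  have hfin : IsFiniteMeasure γ := by
    refine ⟨?_⟩
    have : γ Set.univ = μ Set.univ := by
      rw [← hγ.1, Measure.map_apply measurable_fst MeasurableSet.univ, Set.preimage_univ]
    rw [this]; exact measure_lt_top _ _
  have hint : ∀ {Y : Type _} [TopologicalSpace Y] [CompactSpace Y] [MeasurableSpace Y]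
      [OpensMeasurableSpace Y] (ρ : Measure Y) [IsFiniteMeasure ρ] (ψ : Y → ℝ), Continuous ψ →
      Integrable ψ ρ := fun ρ _ ψ h => h.integrable_of_hasCompactSupport
        (HasCompactSupport.of_compactSpace ψ)
  have h1 : ∫ x, φ x ∂μ = ∫ z, φ z.1 ∂γ := by
    rw [← hγ.1]
    exact integral_map measurable_fst.aemeasurable hφ.continuous.aestronglyMeasurable
  have h2 : ∫ x, φ x ∂ν = ∫ z, φ z.2 ∂γ := by
    rw [← hγ.2]
    exact integral_map measurable_snd.aemeasurable hφ.continuous.aestronglyMeasurable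
  have hc1 : Continuous fun z : X × X => φ z.1 := hφ.continuous.comp continuous_fst
  have hc2 : Continuous fun z : X × X => φ z.2 := hφ.continuous.comp continuous_snd
  rw [h1, h2, ← integral_sub (hint γ _ hc1) (hint γ _ hc2)]
  calc ENNReal.ofReal (∫ z, (φ z.1 - φ z.2) ∂γ)
      ≤ ENNReal.ofReal (∫ z, dist z.1 z.2 ∂γ) := by
        refine ENNReal.ofReal_le_ofReal (integral_mono (hint γ _ (hc1.sub hc2))
          (hint γ _ (by fun_prop)) fun z => ?_)
        have := hφ.dist_le_mul z.1 z.2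
        rw [NNReal.coe_one, one_mul, Real.dist_eq] at this
        exact (le_abs_self _).trans this
    _ = ∫⁻ z, edist z.1 z.2 ∂γ := by
        rw [ofReal_integral_eq_lintegral_ofReal (hint γ _ (by fun_prop))
          (Filter.Eventually.of_forall fun z => dist_nonneg)]
        simp only [edist_dist]

theorem Torus.measureReal_infDist_lt_le {Z : Set Torus} (hZ : Z.Finite) (hne : Z.Nonempty) (t : ℝ)
    (ht : 0 ≤ t) : volume.real {x : Torus | Metric.infDist x Z < t} ≤ Z.ncard * (2 * t) := by
  have hsub : {x : Torus | Metric.infDist x Z < t} ⊆ ⋃ z ∈ hZ.toFinset, Metric.closedBall z t := by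
    intro x hx
    obtain ⟨z, hz, hd⟩ := (Metric.infDist_lt_iff hne).1 hx
    simp only [Set.mem_iUnion]
    exact ⟨z, hZ.mem_toFinset.2 hz, hd.le⟩
  calc volume.real {x : Torus | Metric.infDist x Z < t}
      ≤ volume.real (⋃ z ∈ hZ.toFinset, Metric.closedBall z t) := measureReal_mono hsub
          (measure_ne_top _ _)
    _ ≤ ∑ z ∈ hZ.toFinset, volume.real (Metric.closedBall z t) := measureReal_biUnion_finset_le _ _
    _ ≤ ∑ z ∈ hZ.toFinset, 2 * t := Finset.sum_le_sum fun z _ => by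
        rw [measureReal_def, AddCircle.volume_closedBall,
          ENNReal.toReal_ofReal (le_min two_pi_pos.le (by linarith))]
        exact min_le_right _ _
    _ = Z.ncard * (2 * t) := by
        rw [Finset.sum_const, nsmul_eq_mul, Set.ncard_eq_toFinset_card Z hZ]

theorem Torus.integrable_of_continuous {E : Type*} [NormedAddCommGroup E] {g : Torus → E}
    (hg : Continuous g) : Integrable g :=
  hg.integrable_of_hasCompactSupport (HasCompactSupport.of_compactSpace g)

/-- A bounded function cannot concentrate near a finite set. -/
theorem Torus.sq_integral_abs_le {g : Torus → ℝ} (hg : Continuous g) {Z : Set Torus}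
    (hZ : Z.Finite) (hne : Z.Nonempty) {M : ℝ} (hM : 0 < M) (hgM : ∀ᵐ x, |g x| ≤ M) :
    (∫ x, |g x|) ^ 2 / (8 * Z.ncard * M) ≤ ∫ x, |g x| * Metric.infDist x Z := by
  have hN : 0 < (Z.ncard : ℝ) := by exact_mod_cast (Set.ncard_pos hZ).2 hne
  set A := ∫ x, |g x| with hA
  have hA0 : 0 ≤ A := integral_nonneg fun x => abs_nonneg _
  -- This maximises `t * A - 2 * N * M * t ^ 2`, with maximum `A ^ 2 / (8 * N * M)`.
  set t := A / (4 * Z.ncard * M) with ht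
  have ht0 : 0 ≤ t := by positivity
  set S := {x : Torus | Metric.infDist x Z < t} with hS
  have hSm : MeasurableSet S := (isOpen_lt (Metric.continuous_infDist_pt Z)
    continuous_const).measurableSet
  have hvol := Torus.measureReal_infDist_lt_le hZ hne t ht0
  have hi1 : Integrable fun x => t * |g x| := (integrable_of_continuous hg.abs).const_mul t
  have hi2 : Integrable (S.indicator fun _ : Torus => t * M) :=
    (integrable_const (t * M)).indicator hSm
  -- Off `S` the distance is at least `t`; on `S` the left integrand is nonpositive.
  have hmono : ∫ x, (t * |g x| - S.indicator (fun _ => t * M) x)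
      ≤ ∫ x, |g x| * Metric.infDist x Z := by
    refine integral_mono_ae (hi1.sub hi2)
      (integrable_of_continuous (hg.abs.mul (Metric.continuous_infDist_pt Z))) ?_
    filter_upwards [hgM] with x hx
    by_cases hxS : x ∈ S
    · rw [Set.indicator_of_mem hxS]
      have h1 : t * |g x| ≤ t * M := mul_le_mul_of_nonneg_left hx ht0
      have h2 : 0 ≤ |g x| * Metric.infDist x Z := mul_nonneg (abs_nonneg _) Metric.infDist_nonneg
      linarith
    · rw [Set.indicator_of_notMem hxS, sub_zero, mul_comm]
      exact mul_le_mul_of_nonneg_left (not_lt.1 hxS) (abs_nonneg _)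
  rw [integral_sub hi1 hi2, integral_const_mul, integral_indicator_const _ hSm, smul_eq_mul] at hmono
  refine le_trans ?_ hmono
  calc A ^ 2 / (8 * Z.ncard * M) = t * A - Z.ncard * (2 * t) * (t * M) := by
        rw [ht]; field_simp; ring
    _ ≤ t * A - volume.real S * (t * M) := by gcongr

/-! ### Mean values, densities and the lower bound on the Wasserstein distance -/

theorem meanValue_eq (f : Torus → ℝ) : meanValue f = (2 * π)⁻¹ * ∫ x, f x := by
  rw [meanValue, average_eq, measureReal_def, AddCircle.measure_univ,
    ENNReal.toReal_ofReal two_pi_pos.le, smul_eq_mul]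

theorem integral_eq_meanValue (f : Torus → ℝ) : ∫ x, f x = 2 * π * meanValue f := by
  rw [meanValue_eq, mul_inv_cancel_left₀ two_pi_pos.ne']

theorem integral_const_torus (c : ℝ) : ∫ _ : Torus, c = 2 * π * c := by
  rw [integral_const, measureReal_def, AddCircle.measure_univ,
    ENNReal.toReal_ofReal two_pi_pos.le, smul_eq_mul]

theorem integral_sub_meanValue {f : Torus → ℝ} (hf : Continuous f) :
    ∫ x, (f x - meanValue f) = 0 := by
  rw [integral_sub (Torus.integrable_of_continuous hf) (integrable_const _), integral_const_torus,
    integral_eq_meanValue, sub_self]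

/-- Otherwise `f - meanValue f` has constant sign by `Torus.exists_zero_between`, contradicting its
zero integral. This makes `infDist` to the level set meaningful, and later supplies the point where
the torus is cut. -/
theorem exists_eq_meanValue {f : Torus → ℝ} (hf : Continuous f) : ∃ x, f x = meanValue f := by
  by_contra! hne
  have hint := integral_sub_meanValue hf
  have hc : Continuous fun x => f x - meanValue f := hf.sub continuous_const
  have h0 : f 0 - meanValue f ≠ 0 := sub_ne_zero.2 (hne 0)
  rcases h0.lt_or_gt with h | h
  · have hneg : ∀ x, f x - meanValue f ≤ 0 := fun x => by
      by_contra hx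
      obtain ⟨z, hz, -⟩ := Torus.exists_zero_between hc (x := 0) (y := x)
        (mul_nonpos_of_nonpos_of_nonneg h.le (not_le.1 hx).le)
      exact hne z (sub_eq_zero.1 hz)
    have := (hc.neg.integral_pos_of_hasCompactSupport_nonneg_nonzero (μ := volume)
      (HasCompactSupport.of_compactSpace _) (fun x => neg_nonneg.2 (hneg x)) (x := 0)
      (neg_ne_zero.2 h0))
    rw [integral_neg', hint] at this
    simp at this
  · have hpos : ∀ x, 0 ≤ f x - meanValue f := fun x => by
      by_contra hx
      obtain ⟨z, hz, -⟩ := Torus.exists_zero_between hc (x := 0) (y := x)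
        (mul_nonpos_of_nonneg_of_nonpos h.le (not_le.1 hx).le)
      exact hne z (sub_eq_zero.1 hz)
    have := (hc.integral_pos_of_hasCompactSupport_nonneg_nonzero (μ := volume)
      (HasCompactSupport.of_compactSpace _) hpos (x := 0) h0)
    rw [hint] at this
    exact lt_irrefl _ this

theorem integral_densityMeasure {f : Torus → ℝ} (hf : Continuous f) (h0 : ∀ x, 0 ≤ f x)
    (φ : Torus → ℝ) : ∫ x, φ x ∂densityMeasure f = ∫ x, f x * φ x := by
  rw [densityMeasure, integral_withDensity_eq_integral_toReal_smul
    hf.measurable.ennreal_ofReal (Filter.Eventually.of_forall fun x => ENNReal.ofReal_lt_top)]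
  simp only [ENNReal.toReal_ofReal (h0 _), smul_eq_mul]

theorem isFiniteMeasure_densityMeasure {f : Torus → ℝ} (hf : Continuous f) :
    IsFiniteMeasure (densityMeasure f) :=
  isFiniteMeasure_withDensity_ofReal (Torus.integrable_of_continuous hf).2

theorem meanValue_nonneg {f : Torus → ℝ} (h0 : ∀ x, 0 ≤ f x) : 0 ≤ meanValue f := by
  rw [meanValue_eq]
  exact mul_nonneg (by positivity) (integral_nonneg h0)

/-- The test function is `signedZeroDist`, whose sign matches that of `f - meanValue f`. -/
theorem ofReal_integral_abs_mul_infDist_le_wasserstein {f : Torus → ℝ} (hf : Continuous f)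
    (h0 : ∀ x, 0 ≤ f x) :
    ENNReal.ofReal (∫ x, |f x - meanValue f| * Metric.infDist x {z | f z = meanValue f})
      ≤ wasserstein 1 (densityMeasure f) (densityMeasure fun _ => meanValue f) := by
  have hc : Continuous fun x => f x - meanValue f := hf.sub continuous_const
  have := isFiniteMeasure_densityMeasure hf
  have := isFiniteMeasure_densityMeasure (f := fun _ => meanValue f) continuous_const
  have hL := lipschitzWith_signedZeroDist hc
  have h := ofReal_integral_sub_le_wasserstein (μ := densityMeasure f)
    (ν := densityMeasure fun _ => meanValue f) hL
  have hi1 : Integrable fun x => f x * signedZeroDist (fun x => f x - meanValue f) x :=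
    Torus.integrable_of_continuous (hf.mul hL.continuous)
  have hi2 : Integrable fun x => meanValue f * signedZeroDist (fun x => f x - meanValue f) x :=
    Torus.integrable_of_continuous (continuous_const.mul hL.continuous)
  rw [integral_densityMeasure hf h0,
    integral_densityMeasure continuous_const fun _ => meanValue_nonneg h0,
    ← integral_sub hi1 hi2] at h
  convert h using 4 with x
  rw [← sub_mul, mul_signedZeroDist (fun x => f x - meanValue f)]
  simp only [sub_eq_zero]

theorem eLpNorm_one_eq_ofReal {g : Torus → ℝ} (hg : Continuous g) :
    eLpNorm g 1 volume = ENNReal.ofReal (∫ x, |g x|) := by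
  rw [eLpNorm_one_eq_lintegral_enorm,
    ofReal_integral_eq_lintegral_ofReal (Torus.integrable_of_continuous hg.abs)
      (Filter.Eventually.of_forall fun x => abs_nonneg _)]
  simp only [Real.enorm_eq_ofReal_abs]

theorem Torus.memLp_top_of_continuous {g : Torus → ℝ} (hg : Continuous g) :
    MemLp g ∞ volume :=
  hg.memLp_top_of_hasCompactSupport (HasCompactSupport.of_compactSpace g) _

theorem Torus.ae_abs_le {g : Torus → ℝ} (hg : Continuous g) :
    ∀ᵐ x, |g x| ≤ (eLpNorm g ∞ volume).toReal := by
  have hfin := (memLp_top_of_continuous hg).2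
  filter_upwards [enorm_ae_le_eLpNormEssSup g volume] with x hx
  rw [eLpNorm_exponent_top] at hfin ⊢
  rw [Real.enorm_eq_ofReal_abs] at hx
  exact (ENNReal.ofReal_le_iff_le_toReal hfin.ne).1 hx

/-- Almost every value of `f`, and its mean, lie in `[0, ‖f‖_∞]`, so no factor 2 is lost. -/
theorem Torus.ae_abs_sub_meanValue_le {f : Torus → ℝ} (hf : Continuous f) (h0 : ∀ x, 0 ≤ f x) :
    ∀ᵐ x, |f x - meanValue f| ≤ (eLpNorm f ∞ volume).toReal := by
  have hae := ae_abs_le hf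
  have hm : meanValue f ≤ (eLpNorm f ∞ volume).toReal := by
    have : ∫ x, f x ≤ ∫ _ : Torus, (eLpNorm f ∞ volume).toReal :=
      integral_mono_ae (integrable_of_continuous hf) (integrable_const _) (by
        filter_upwards [hae] with x hx using (le_abs_self _).trans hx)
    rw [integral_const_torus, integral_eq_meanValue] at this
    exact le_of_mul_le_mul_left this two_pi_pos
  filter_upwards [hae] with x hx
  have h1 := (le_abs_self _).trans hx
  have := h0 x
  have := meanValue_nonneg h0
  rw [abs_le]; constructor <;> linarith

theorem numSolutions_mul_wasserstein_ge {f : Torus → ℝ} (hf : Continuous f) (h0 : ∀ x, 0 ≤ f x) :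
    ((1 / 8 : ℝ≥0) : ℝ≥0∞) *
          (eLpNorm (fun x => f x - meanValue f) 1 volume ^ 2 / eLpNorm f ∞ volume)
        ≤ numSolutions f (meanValue f) *
          wasserstein 1 (densityMeasure f) (densityMeasure fun _ => meanValue f) := by
  have hc : Continuous fun x => f x - meanValue f := hf.sub continuous_const
  have hW := ofReal_integral_abs_mul_infDist_le_wasserstein hf h0
  set Z := {z : Torus | f z = meanValue f} with hZdef
  have hne : Z.Nonempty := exists_eq_meanValue hf
  rw [eLpNorm_one_eq_ofReal hc]
  by_cases hconst : ∀ x, f x = meanValue f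
  · simp [hconst]
  push Not at hconst
  obtain ⟨x₀, hx₀⟩ := hconst
  have hfin := (Torus.memLp_top_of_continuous hf).2
  have hgM := Torus.ae_abs_sub_meanValue_le hf h0
  by_cases hZ : Z.Finite
  · have hM : 0 < (eLpNorm f ∞ volume).toReal := by
      by_contra hn
      have hae : ∀ᵐ x, f x - meanValue f = 0 := by
        filter_upwards [hgM] with x hx
        exact abs_nonpos_iff.1 (hx.trans (not_lt.1 hn))
      have := (hc.ae_eq_iff_eq volume continuous_const).1 hae
      exact hx₀ (sub_eq_zero.1 (congrFun this x₀))
    have hN : 0 < Z.ncard := (Set.ncard_pos hZ).2 hne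
    have hNr : 0 < (Z.ncard : ℝ) := by exact_mod_cast hN
    have key := Torus.sq_integral_abs_le hc hZ hne hM hgM
    set A := ∫ x, |f x - meanValue f|
    have hA0 : 0 ≤ A := integral_nonneg fun x => abs_nonneg _
    have hnum : numSolutions f (meanValue f) = ENNReal.ofReal Z.ncard := by
      rw [numSolutions, ← hZdef, ← hZ.cast_ncard_eq, ENNReal.ofReal_natCast]
      rfl
    rw [hnum, ← ENNReal.ofReal_toReal hfin.ne]
    refine le_trans ?_ (mul_le_mul_right ((ENNReal.ofReal_le_ofReal key).trans hW) _)
    rw [← ENNReal.ofReal_mul hNr.le, ← ENNReal.ofReal_pow hA0, ← ENNReal.ofReal_div_of_pos hM,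
      ← ENNReal.ofReal_coe_nnreal, ← ENNReal.ofReal_mul (NNReal.coe_nonneg _)]
    refine ENNReal.ofReal_le_ofReal (le_of_eq ?_)
    push_cast
    field_simp
  · have hnum : numSolutions f (meanValue f) = ∞ := by
      rw [numSolutions, ← hZdef, Set.Infinite.encard_eq hZ]
      rfl
    -- Since `∞ * 0 = 0`, the distance must be shown nonzero: `x₀` lies outside the closed set `Z`,
    -- so the integrand is positive there.
    have hpos : 0 < ∫ x, |f x - meanValue f| * Metric.infDist x Z := by
      refine (hc.abs.mul
        (Metric.continuous_infDist_pt Z)).integral_pos_of_hasCompactSupport_nonneg_nonzero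
        (HasCompactSupport.of_compactSpace _)
        (fun x => mul_nonneg (abs_nonneg _) Metric.infDist_nonneg) (x := x₀) ?_
      refine mul_ne_zero (abs_ne_zero.2 (sub_ne_zero.2 hx₀)) ?_
      have hcl : IsClosed Z := isClosed_eq hf continuous_const
      exact ((hcl.notMem_iff_infDist_pos hne).1 hx₀).ne'
    have hWne : wasserstein 1 (densityMeasure f) (densityMeasure fun _ => meanValue f) ≠ 0 :=
      ((ENNReal.ofReal_pos.2 hpos).trans_le hW).ne'
    rw [hnum, ENNReal.top_mul hWne]
    exact le_top

/-! ### Primitives and the transport map -/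

theorem Torus.intervalIntegral_eq {E : Type*} [NormedAddCommGroup E] [NormedSpace ℝ E] (a : ℝ)
    (g : Torus → E) : ∫ x in a..a + 2 * π, g (x : Torus) = ∫ x, g x :=
  AddCircle.intervalIntegral_preimage (2 * π) a g

/-- A function on the torus of mean value zero has a primitive of mean value zero. -/
theorem Torus.exists_primitive {g : Torus → ℝ} (hg : Continuous g) (h0 : ∫ x, g x = 0) :
    ∃ F : Torus → ℝ, Continuous F ∧ meanValue F = 0 ∧
      ∀ x : ℝ, HasDerivAt (fun x : ℝ => F (x : Torus)) (g (x : Torus)) x := by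
  have hgc : Continuous fun x : ℝ => g (x : Torus) := hg.comp (AddCircle.continuous_mk' _)
  have hd : ∀ x : ℝ, HasDerivAt (fun x : ℝ => ∫ y in (0 : ℝ)..x, g (y : Torus)) (g (x : Torus)) x :=
    fun x => (hgc.integral_hasStrictDerivAt 0 x).hasDerivAt
  have hper : Function.Periodic (fun x : ℝ => ∫ y in (0 : ℝ)..x, g (y : Torus)) (2 * π) := by
    intro x
    have := intervalIntegral.integral_add_adjacent_intervals (μ := volume)
      (hgc.intervalIntegrable 0 x) (hgc.intervalIntegrable x (x + 2 * π))
    rw [intervalIntegral_eq, h0, add_zero] at this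
    exact this.symm
  have hcont : Continuous hper.lift :=
    continuous_coinduced_dom.2 (continuous_iff_continuousAt.2 fun x => (hd x).continuousAt)
  refine ⟨fun x => hper.lift x - meanValue hper.lift, hcont.sub continuous_const, ?_, fun x => ?_⟩
  · rw [meanValue_eq, integral_sub_meanValue hcont, mul_zero]
  · exact (hd x).sub_const _

theorem Torus.edist_coe_le (x y : ℝ) :
    edist (x : Torus) (y : Torus) ≤ ENNReal.ofReal |x - y| := by
  rw [edist_dist, dist_eq_norm, ← AddCircle.coe_sub]
  exact ENNReal.ofReal_le_ofReal QuotientAddGroup.norm_mk_le_norm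

/-- The monotone rearrangement, cutting the torus at a zero of the primitive `F` of `f - m`, costs
`∫ |F|`. -/
theorem wasserstein_le_integral_abs_primitive {f : Torus → ℝ} (hf : Continuous f)
    (h0 : ∀ x, 0 ≤ f x) (hm : 0 < meanValue f) {F : Torus → ℝ} (hF : Continuous F)
    (hderiv : ∀ x : ℝ, HasDerivAt (fun x : ℝ => F (x : Torus)) (f (x : Torus) - meanValue f) x)
    {a : ℝ} (ha : F (a : Torus) = 0) :
    wasserstein 1 (densityMeasure f) (densityMeasure fun _ => meanValue f)
      ≤ ENNReal.ofReal (∫ x, |F x|) := by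
  set m := meanValue f with hmdef
  have hcoe : Continuous ((↑) : ℝ → Torus) := AddCircle.continuous_mk' _
  have hfc : Continuous fun x : ℝ => f (x : Torus) := hf.comp hcoe
  have hFc : Continuous fun x : ℝ => F (x : Torus) := hF.comp hcoe
  have hFa : F ((a + 2 * π : ℝ) : Torus) = 0 := by rw [AddCircle.coe_add_period, ha]
  -- The transport map: `m * G' = f`, and `G` fixes both `a` and `a + 2 * π` because `F` vanishes
  -- there.
  let G : ℝ → ℝ := fun x => x + F (x : Torus) / m
  have hG : Continuous G := continuous_id.add (hFc.div_const m)
  have hGd : ∀ x : ℝ, HasDerivAt G (f (x : Torus) / m) x := fun x => by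
    refine ((hasDerivAt_id x).add ((hderiv x).div_const m)).congr_deriv ?_
    field_simp; ring
  let ρ : Measure ℝ := (volume.restrict (Set.Ioc a (a + 2 * π))).withDensity
    fun x => ENNReal.ofReal (f (x : Torus))
  have hle : a ≤ a + 2 * π := by linarith [two_pi_pos]
  have hρfin : IsFiniteMeasure ρ :=
    isFiniteMeasure_withDensity_ofReal (hfc.integrableOn_Ioc (a := a) (b := a + 2 * π)).2
  have hρ : ∀ ψ : ℝ → ℝ, ∫ x, ψ x ∂ρ = ∫ x in a..a + 2 * π, f (x : Torus) * ψ x := fun ψ => by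
    rw [intervalIntegral.integral_of_le hle, integral_withDensity_eq_integral_toReal_smul
      hfc.measurable.ennreal_ofReal (Filter.Eventually.of_forall fun x => ENNReal.ofReal_lt_top)]
    simp only [ENNReal.toReal_ofReal (h0 _), smul_eq_mul]
  let P : ℝ → Torus × Torus := fun x => ((x : Torus), (G x : Torus))
  have hP : Continuous P := hcoe.prodMk (hcoe.comp hG)
  have hfin1 := isFiniteMeasure_densityMeasure hf
  have hfin2 := isFiniteMeasure_densityMeasure (f := fun _ => m) continuous_const
  have hcoup : ρ.map P ∈ couplings (densityMeasure f) (densityMeasure fun _ => m) := by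
    constructor
    · rw [Measure.map_map measurable_fst hP.measurable]
      refine ext_of_forall_integral_eq_of_IsFiniteMeasure fun φ => ?_
      change ∫ x, φ x ∂(ρ.map fun x : ℝ => (x : Torus)) = _
      rw [integral_map (hcoe.measurable.aemeasurable) φ.continuous.aestronglyMeasurable,
        integral_densityMeasure hf h0, hρ]
      exact Torus.intervalIntegral_eq a fun x => f x * φ x
    · have hcG : Measurable fun x : ℝ => (G x : Torus) := (hcoe.comp hG).measurable
      rw [Measure.map_map measurable_snd hP.measurable]
      refine ext_of_forall_integral_eq_of_IsFiniteMeasure fun φ => ?_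
      have hφ : Continuous fun x : ℝ => φ (x : Torus) := φ.continuous.comp hcoe
      change ∫ x, φ x ∂(ρ.map fun x : ℝ => (G x : Torus)) = _
      rw [integral_map hcG.aemeasurable φ.continuous.aestronglyMeasurable,
        integral_densityMeasure continuous_const fun _ => hm.le, hρ,
        ← Torus.intervalIntegral_eq a fun x => m * φ x, intervalIntegral.integral_const_mul]
      -- Substituting `u = G x` identifies the second marginal; `G` need not be injective, so `f`
      -- may vanish on arcs.
      have hsub := intervalIntegral.integral_comp_mul_deriv (a := a) (b := a + 2 * π)
        (fun x _ => hGd x) (hfc.div_const m).continuousOn hφ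
      have hGa : G a = a := by simp [G, ha]
      have hGb : G (a + 2 * π) = a + 2 * π := by simp only [G, hFa, zero_div, add_zero]
      rw [hGa, hGb] at hsub
      rw [← hsub, ← intervalIntegral.integral_const_mul]
      refine intervalIntegral.integral_congr fun x _ => ?_
      simp only [Function.comp_apply]
      field_simp
  -- With `f = m + F'`, the integrand is `|F| + |F| * F' / m`; the last term is an exact derivative
  -- and integrates to zero since `F` vanishes at both ends.
  have hcost : ∫ x, |F (x : Torus) / m| ∂ρ = ∫ x, |F x| := by
    rw [hρ, ← Torus.intervalIntegral_eq a fun x => |F x|]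
    have hsub := intervalIntegral.integral_comp_mul_deriv (a := a) (b := a + 2 * π)
      (fun x _ => hderiv x) (hfc.sub continuous_const).continuousOn continuous_abs
    rw [ha, hFa, intervalIntegral.integral_same] at hsub
    have hi1 : IntervalIntegrable (fun x : ℝ => |F (x : Torus)|) volume a (a + 2 * π) :=
      hFc.abs.intervalIntegrable _ _
    have hi2 : IntervalIntegrable (fun x : ℝ => m⁻¹ * (((fun u => |u|) ∘ fun x : ℝ => F (x : Torus)) x
        * (f (x : Torus) - m))) volume a (a + 2 * π) :=
      (continuous_const.mul (hFc.abs.mul (hfc.sub continuous_const))).intervalIntegrable _ _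
    rw [← add_zero (∫ x in a..a + 2 * π, |F (x : Torus)|), ← mul_zero m⁻¹, ← hsub,
      ← intervalIntegral.integral_const_mul, ← intervalIntegral.integral_add hi1 hi2]
    refine intervalIntegral.integral_congr fun x _ => ?_
    simp only [Function.comp_apply, abs_div, abs_of_pos hm]
    field_simp
    ring
  unfold wasserstein
  simp only [ENNReal.rpow_one, div_one]
  refine (iInf₂_le _ hcoup).trans ?_
  rw [lintegral_map measurable_edist hP.measurable, ← hcost,
    ofReal_integral_eq_lintegral_ofReal _ (Filter.Eventually.of_forall fun x => abs_nonneg _)]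
  · refine lintegral_mono fun x => (Torus.edist_coe_le x (G x)).trans (le_of_eq ?_)
    simp only [G, sub_add_cancel_left, abs_neg]
  · obtain ⟨B, hB⟩ := (isCompact_range hF).isBounded.exists_norm_le
    refine Integrable.of_bound (hFc.div_const m).abs.aestronglyMeasurable (B / m)
      (Filter.Eventually.of_forall fun x => ?_)
    rw [norm_abs_eq_norm, norm_div, Real.norm_of_nonneg hm.le]
    exact div_le_div_of_nonneg_right (hB _ ⟨_, rfl⟩) hm.le

/-! ### Parseval and the upper bound by the negative Sobolev norm -/

/-- Cauchy–Schwarz, by expanding `0 ≤ ∫ (|F| - s) ^ 2` with `s` the mean of `|F|`. -/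
theorem Torus.sq_integral_abs_le_integral_sq {F : Torus → ℝ} (hF : Continuous F) :
    (∫ x, |F x|) ^ 2 ≤ 2 * π * ∫ x, F x ^ 2 := by
  set A := ∫ x, |F x|
  set s := A / (2 * π) with hs
  have hi1 : Integrable fun x => F x ^ 2 := integrable_of_continuous (hF.pow 2)
  have hi2 : Integrable fun x => 2 * s * |F x| := (integrable_of_continuous hF.abs).const_mul _
  have hi12 : Integrable fun x => F x ^ 2 - 2 * s * |F x| := hi1.sub hi2
  have h : 0 ≤ ∫ x, (F x ^ 2 - 2 * s * |F x| + s ^ 2) := integral_nonneg fun x => by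
    have : F x ^ 2 - 2 * s * |F x| + s ^ 2 = (|F x| - s) ^ 2 := by rw [← sq_abs (F x)]; ring
    simp only [Pi.zero_apply, this]
    positivity
  rw [integral_add hi12 (integrable_const _), integral_sub hi1 hi2, integral_const_mul,
    integral_const_torus] at h
  have h2 : 2 * s * A - 2 * π * s ^ 2 = A ^ 2 / (2 * π) := by rw [hs]; field_simp; ring
  have h3 : A ^ 2 / (2 * π) ≤ ∫ x, F x ^ 2 := by linarith
  rw [div_le_iff₀ two_pi_pos] at h3
  linarith

theorem fourierCoeff_eq_fourierCoeffOn (g : Torus → ℂ) (n : ℤ) :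
    fourierCoeff g n =
      fourierCoeffOn (lt_add_of_pos_right 0 two_pi_pos) (fun x : ℝ => g (x : Torus)) n := by
  rw [← fourierCoeff_liftIoc_eq]
  congr 1
  funext x
  exact congrArg g AddCircle.coe_equivIoc.symm

theorem fourierCoeff_ofReal_neg (g : Torus → ℝ) (n : ℤ) :
    ‖fourierCoeff (fun x => (g x : ℂ)) (-n)‖ = ‖fourierCoeff (fun x => (g x : ℂ)) n‖ := by
  rw [← RCLike.norm_conj (fourierCoeff _ n), fourierCoeff, fourierCoeff, ← integral_conj]
  congr 2
  funext x
  rw [neg_neg, smul_eq_mul, smul_eq_mul, map_mul, fourier_neg, Complex.conj_conj,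
    Complex.conj_ofReal]

theorem Torus.integrable_haar_of_continuous {E : Type*} [NormedAddCommGroup E] {g : Torus → E}
    (hg : Continuous g) : Integrable g AddCircle.haarAddCircle :=
  hg.integrable_of_hasCompactSupport (HasCompactSupport.of_compactSpace g)

theorem fourierCoeff_add_const {g : Torus → ℝ} (hg : Continuous g) (c : ℝ) {n : ℤ} (hn : n ≠ 0) :
    fourierCoeff (fun x => ((g x + c : ℝ) : ℂ)) n = fourierCoeff (fun x => (g x : ℂ)) n := by
  have h1 : (fun x : Torus => ((g x + c : ℝ) : ℂ))
      = (fun x => (g x : ℂ)) + ((c : ℂ) • ⇑(fourier 0 : C(Torus, ℂ))) := by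
    funext x; simp
  have hi1 : Integrable (fun x => (g x : ℂ)) AddCircle.haarAddCircle :=
    Torus.integrable_haar_of_continuous (Complex.continuous_ofReal.comp hg)
  have hi2 : Integrable ((c : ℂ) • ⇑(fourier 0 : C(Torus, ℂ))) AddCircle.haarAddCircle :=
    Torus.integrable_haar_of_continuous ((fourier 0).continuous.const_smul (c : ℂ))
  rw [h1, fourierCoeff.add hi1 hi2,
    Pi.add_apply, fourierCoeff.const_smul, fourierCoeff_fourier, Pi.single_eq_of_ne hn, smul_zero,
    add_zero]

/-- Integration by parts over a period: the boundary term cancels, and `m` only affects the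
coefficient at `0`. -/
theorem fourierCoeff_primitive {f F : Torus → ℝ} (hf : Continuous f) {m : ℝ}
    (hderiv : ∀ x : ℝ, HasDerivAt (fun x : ℝ => F (x : Torus)) (f (x : Torus) - m) x)
    {n : ℤ} (hn : n ≠ 0) :
    ‖fourierCoeff (fun x => (F x : ℂ)) n‖ = ‖fourierCoeff (fun x => (f x : ℂ)) n‖ / |(n : ℝ)| := by
  have hfc : Continuous fun x : ℝ => f (x : Torus) := hf.comp (AddCircle.continuous_mk' _)
  have hfm := fourierCoeff_add_const hf (-m) hn
  rw [fourierCoeff_eq_fourierCoeffOn] at hfm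
  rw [fourierCoeff_eq_fourierCoeffOn, fourierCoeffOn_of_hasDerivAt
    (f' := fun x : ℝ => ((f (x : Torus) + -m : ℝ) : ℂ)) _ hn
    (fun x _ => (hderiv x).ofReal_comp)
    ((Complex.continuous_ofReal.comp (hfc.add continuous_const)).intervalIntegrable _ _), hfm]
  have hz : ((0 + 2 * π : ℝ) : Torus) = ((0 : ℝ) : Torus) := AddCircle.coe_add_period _ _
  rw [hz, sub_self, mul_zero, zero_sub, norm_mul, norm_neg, norm_mul]
  simp only [zero_add, Complex.ofReal_zero, sub_zero, norm_div, norm_one, norm_mul, norm_neg,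
    Complex.norm_ofNat, Complex.norm_real, Complex.norm_I, Complex.norm_intCast, Real.norm_eq_abs,
    abs_of_pos pi_pos, mul_one, Complex.ofReal_mul, Complex.ofReal_ofNat]
  have : |(n : ℝ)| ≠ 0 := by simpa using hn
  field_simp

/-- Parseval for `F`: the zeroth coefficient vanishes and those at `k` and `-k` have equal modulus,
so `4 * π` is the period `2 * π` times 2. -/
theorem integral_sq_primitive {f F : Torus → ℝ} (hf : Continuous f) (hF : Continuous F)
    (hF0 : meanValue F = 0) {m : ℝ}
    (hderiv : ∀ x : ℝ, HasDerivAt (fun x : ℝ => F (x : Torus)) (f (x : Torus) - m) x) :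
    ∃ S : ℝ, 0 ≤ S ∧ ∫ x, F x ^ 2 = 4 * π * S ∧ negSobolevNorm f = ENNReal.ofReal √S := by
  let Fc : C(Torus, ℂ) := ⟨fun x => (F x : ℂ), Complex.continuous_ofReal.comp hF⟩
  have hsum := hasSum_sq_fourierCoeff (ContinuousMap.toLp (E := ℂ) 2 AddCircle.haarAddCircle ℂ Fc)
  simp only [fourierCoeff_toLp] at hsum
  have hint : ∫ x, ‖ContinuousMap.toLp (E := ℂ) 2 AddCircle.haarAddCircle ℂ Fc x‖ ^ 2
      ∂AddCircle.haarAddCircle = (2 * π)⁻¹ * ∫ x, F x ^ 2 := by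
    refine Eq.trans ?_ AddCircle.integral_haarAddCircle
    refine integral_congr_ae ?_
    filter_upwards [ContinuousMap.coeFn_toLp (p := 2) (𝕜 := ℂ) AddCircle.haarAddCircle Fc] with x hx
    rw [hx]
    simp [Fc]
  rw [hint] at hsum
  have hc0 : fourierCoeff Fc 0 = 0 := by
    have h1 : fourierCoeff Fc 0 = ∫ x, ((F x : ℝ) : ℂ) ∂AddCircle.haarAddCircle := by
      simp [fourierCoeff, Fc]
    rw [h1, integral_complex_ofReal, AddCircle.integral_haarAddCircle, integral_eq_meanValue, hF0]
    simp
  have hev : Function.Even fun n : ℤ => ‖fourierCoeff Fc n‖ ^ 2 := fun n => by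
    simp only [Fc, ContinuousMap.coe_mk, fourierCoeff_ofReal_neg]
  have htsum := tsum_int_eq_zero_add_two_mul_tsum_pnat hev hsum.summable
  rw [hsum.tsum_eq, hc0, norm_zero] at htsum
  have hterm : ∀ k : ℕ+, ‖fourierCoeff Fc ((k : ℕ) : ℤ)‖ ^ 2
      = ‖fourierCoeff (fun x : Torus => (f x : ℂ)) ((k : ℕ) : ℤ)‖ ^ 2 / ((k : ℕ) : ℝ) ^ 2 :=
    fun k => by
      have := fourierCoeff_primitive (n := ((k : ℕ) : ℤ)) hf hderiv (by exact_mod_cast k.ne_zero)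
      simp only [Fc, ContinuousMap.coe_mk, this, div_pow, Int.cast_natCast, Nat.abs_cast]
  have hsumm : Summable fun k : ℕ+ => ‖fourierCoeff Fc ((k : ℕ) : ℤ)‖ ^ 2 :=
    hsum.summable.comp_injective (i := fun k : ℕ+ => ((k : ℕ) : ℤ))
      (Nat.cast_injective.comp PNat.coe_injective)
  have hSnn : 0 ≤ ∑' k : ℕ+, ‖fourierCoeff Fc ((k : ℕ) : ℤ)‖ ^ 2 :=
    tsum_nonneg fun k => by positivity
  refine ⟨∑' k : ℕ+, ‖fourierCoeff Fc ((k : ℕ) : ℤ)‖ ^ 2, hSnn, ?_, ?_⟩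
  · rw [inv_mul_eq_iff_eq_mul₀ two_pi_pos.ne'] at htsum
    rw [htsum, two_nsmul]
    ring
  · rw [negSobolevNorm, Real.sqrt_eq_rpow, ← ENNReal.ofReal_rpow_of_nonneg hSnn (by norm_num),
      ENNReal.ofReal_tsum_of_nonneg (fun k => by positivity) hsumm]
    congr 2
    funext k
    rw [hterm, ENNReal.ofReal_div_of_pos (by have := k.pos; positivity),
      ENNReal.ofReal_pow (norm_nonneg _), ENNReal.ofReal_pow (Nat.cast_nonneg _),
      ofReal_norm, ENNReal.ofReal_natCast]

theorem wasserstein_zero {X : Type*} [MeasurableSpace X] [PseudoEMetricSpace X] :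
    wasserstein 1 (0 : Measure X) 0 = 0 := by
  unfold wasserstein
  simp only [ENNReal.rpow_one, div_one]
  exact le_antisymm ((iInf₂_le (0 : Measure (X × X)) (by simp [couplings])).trans (by simp)) bot_le

theorem wasserstein_le_negSobolevNorm {f : Torus → ℝ} (hf : Continuous f) (h0 : ∀ x, 0 ≤ f x) :
    wasserstein 1 (densityMeasure f) (densityMeasure fun _ => meanValue f)
      ≤ ((12 : ℝ≥0) : ℝ≥0∞) * negSobolevNorm f := by
  rcases (meanValue_nonneg h0).eq_or_lt with hm | hm
  -- The transport map divides by the mean, so mean zero, where `f = 0`, is separate.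
  · have hz : f =ᵐ[volume] 0 := by
      refine (integral_eq_zero_iff_of_nonneg h0 (Torus.integrable_of_continuous hf)).1 ?_
      rw [integral_eq_meanValue, ← hm, mul_zero]
    have hz' : f = fun _ => 0 := (hf.ae_eq_iff_eq volume continuous_const).1 hz
    have hd : densityMeasure (fun _ => (0 : ℝ)) = 0 := by simp [densityMeasure]
    rw [← hm, hz', hd, wasserstein_zero]
    exact bot_le
  · obtain ⟨F, hF, hF0, hderiv⟩ := Torus.exists_primitive (hf.sub continuous_const)
      (integral_sub_meanValue hf)
    obtain ⟨x, hx⟩ := exists_eq_meanValue hF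
    obtain ⟨a, rfl⟩ := QuotientAddGroup.mk_surjective x
    obtain ⟨S, hS, hFS, hneg⟩ := integral_sq_primitive hf hF hF0 hderiv
    refine (wasserstein_le_integral_abs_primitive hf h0 hm hF hderiv (hx.trans hF0)).trans ?_
    rw [hneg, ← ENNReal.ofReal_coe_nnreal, ← ENNReal.ofReal_mul (NNReal.coe_nonneg _)]
    refine ENNReal.ofReal_le_ofReal (abs_le_of_sq_le_sq' ?_ (by positivity)).2
    have h := Torus.sq_integral_abs_le_integral_sq hF
    rw [hFS] at h
    rw [mul_pow, Real.sq_sqrt hS]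
    refine h.trans ?_
    -- The squared cost is at most `8 * π ^ 2 * S ≤ 128 * S ≤ 12 ^ 2 * S`.
    have hpi : π ^ 2 ≤ 4 ^ 2 := pow_le_pow_left₀ pi_pos.le pi_le_four 2
    push_cast
    nlinarith

/-! ### Sharpness for sine waves -/

theorem sinWave_coe (n : ℕ) (x : ℝ) : sinWave n (x : Torus) = Real.sin (n * x) := rfl

theorem continuous_sinWave (n : ℕ) : Continuous (sinWave n) :=
  continuous_coinduced_dom.2
    (show Continuous fun x : ℝ => Real.sin (n * x) from by fun_prop)

theorem meanValue_sinWave {n : ℕ} (hn : n ≠ 0) : meanValue (sinWave n) = 0 := by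
  rw [meanValue_eq, ← Torus.intervalIntegral_eq 0]
  simp only [sinWave_coe, zero_add]
  rw [intervalIntegral.integral_comp_mul_left (fun x => Real.sin x) (Nat.cast_ne_zero.2 hn),
    integral_sin, Real.cos_nat_mul_two_pi, mul_zero, Real.cos_zero, sub_self, smul_zero, mul_zero]

theorem sinWave_ne_zero {n : ℕ} (hn : n ≠ 0) : sinWave n ≠ 0 := fun h => by
  have h1 := congrFun h ((π / 2 / n : ℝ) : Torus)
  rw [sinWave_coe, mul_div_cancel₀ _ (Nat.cast_ne_zero.2 hn), Real.sin_pi_div_two] at h1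
  exact one_ne_zero h1

theorem numSolutions_sinWave_le {n : ℕ} (hn : n ≠ 0) :
    numSolutions (sinWave n) 0 ≤ ENNReal.ofReal (2 * n) := by
  have hn' : 0 < (n : ℝ) := by positivity
  have hsub : {x : Torus | sinWave n x = 0}
      ⊆ ↑((Finset.range (2 * n)).image fun k : ℕ => ((k * π / n : ℝ) : Torus)) := by
    intro x hx
    obtain ⟨y, hy, rfl⟩ : ∃ y ∈ Set.Ico (0 : ℝ) (0 + 2 * π), (y : Torus) = x :=
      ⟨AddCircle.equivIco (2 * π) 0 x, (AddCircle.equivIco (2 * π) 0 x).2, AddCircle.coe_equivIco⟩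
    obtain ⟨k, hk⟩ := Real.sin_eq_zero_iff.1 (show Real.sin (n * y) = 0 from hx)
    have hk0 : 0 ≤ k := by
      have : (0 : ℝ) ≤ k * π := by rw [hk]; exact mul_nonneg hn'.le hy.1
      exact_mod_cast nonneg_of_mul_nonneg_left this pi_pos
    lift k to ℕ using hk0
    rw [Int.cast_natCast] at hk
    have hkn : k < 2 * n := by
      have : (k : ℝ) * π < (2 * n : ℝ) * π := by
        rw [hk]; nlinarith [hy.2]
      exact_mod_cast lt_of_mul_lt_mul_right this pi_pos.le
    rw [Finset.coe_image]
    refine ⟨k, by simpa using hkn, ?_⟩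
    simp only [hk, mul_div_cancel_left₀ _ hn'.ne']
  have hcard : {x : Torus | sinWave n x = 0}.encard ≤ ((2 * n : ℕ) : ℕ∞) := by
    refine (Set.encard_le_encard hsub).trans ?_
    rw [Set.encard_coe_eq_coe_finsetCard]
    exact_mod_cast Finset.card_image_le.trans (Finset.card_range _).le
  have : ENNReal.ofReal (2 * n) = (((2 * n : ℕ) : ℕ∞) : ℝ≥0∞) := by
    rw [ENat.toENNReal_coe, ← ENNReal.ofReal_natCast (2 * n)]; push_cast; rfl
  rw [this]
  exact ENat.toENNReal_mono hcard

theorem fourierCoeff_sinWave (n : ℕ) (k : ℤ) :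
    fourierCoeff (fun x : Torus => (sinWave n x : ℂ)) k
      = -Complex.I / 2 * (Pi.single (n : ℤ) 1 : ℤ → ℂ) k
        + Complex.I / 2 * (Pi.single (-(n : ℤ)) 1 : ℤ → ℂ) k := by
  have h1 : (fun x : Torus => (sinWave n x : ℂ))
      = ((-Complex.I / 2) • ⇑(fourier (n : ℤ) : C(Torus, ℂ)))
        + ((Complex.I / 2) • ⇑(fourier (-(n : ℤ)) : C(Torus, ℂ))) := by
    funext x
    obtain ⟨y, rfl⟩ := QuotientAddGroup.mk_surjective x
    change ((sinWave n (y : Torus) : ℝ) : ℂ) = -Complex.I / 2 * fourier (n : ℤ) (y : Torus)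
      + Complex.I / 2 * fourier (-(n : ℤ)) (y : Torus)
    have hpi : (π : ℂ) ≠ 0 := Complex.ofReal_ne_zero.2 pi_ne_zero
    have e1 : 2 * (π : ℂ) * Complex.I * ((n : ℤ) : ℂ) * y / ((2 * π : ℝ) : ℂ)
        = n * y * Complex.I := by
      push_cast; field_simp
    have e2 : 2 * (π : ℂ) * Complex.I * ((-(n : ℤ) : ℤ) : ℂ) * y / ((2 * π : ℝ) : ℂ)
        = -(n * y) * Complex.I := by
      push_cast; field_simp
    rw [sinWave_coe, fourier_coe_apply, fourier_coe_apply, e1, e2, Complex.ofReal_sin,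
      Complex.sin]
    push_cast
    ring
  have hi : ∀ (c : ℂ) (j : ℤ), Integrable (c • ⇑(fourier j : C(Torus, ℂ)))
      AddCircle.haarAddCircle := fun c j =>
    Torus.integrable_haar_of_continuous ((fourier j).continuous.const_smul c)
  rw [h1, fourierCoeff.add (hi _ _) (hi _ _), Pi.add_apply, fourierCoeff.const_smul,
    fourierCoeff.const_smul, fourierCoeff_fourier, fourierCoeff_fourier, smul_eq_mul, smul_eq_mul]

theorem negSobolevNorm_sinWave {n : ℕ} (hn : n ≠ 0) :
    negSobolevNorm (sinWave n) = ENNReal.ofReal (1 / (2 * n)) := by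
  have hn' : 0 < (n : ℝ) := by positivity
  have hne : ∀ k : ℕ+, ((k : ℕ) : ℤ) ≠ -(n : ℤ) := fun k => by
    have := k.pos; omega
  obtain ⟨p, rfl⟩ : ∃ p : ℕ+, (p : ℕ) = n := ⟨⟨n, Nat.pos_of_ne_zero hn⟩, rfl⟩
  rw [negSobolevNorm, tsum_eq_single p]
  · rw [fourierCoeff_sinWave, Pi.single_eq_of_ne (hne _)]
    simp only [Pi.single_eq_same, mul_one, mul_zero, add_zero]
    have h2 : ‖-Complex.I / 2‖ₑ = ENNReal.ofReal (1 / 2) := by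
      rw [← ofReal_norm]; simp
    rw [h2, ← ENNReal.ofReal_natCast (p : ℕ), ← ENNReal.ofReal_pow (by norm_num),
      ← ENNReal.ofReal_pow hn'.le, ← ENNReal.ofReal_div_of_pos (by positivity),
      ENNReal.ofReal_rpow_of_nonneg (by positivity) (by norm_num), ← div_pow,
      ← Real.sqrt_eq_rpow, Real.sqrt_sq (by positivity), div_div]
  · intro k hk
    have hkn : ((k : ℕ) : ℤ) ≠ ((p : ℕ) : ℤ) := fun h => hk (PNat.coe_injective (by exact_mod_cast h))
    rw [fourierCoeff_sinWave, Pi.single_eq_of_ne hkn, Pi.single_eq_of_ne (hne k)]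
    simp

theorem abs_sinWave_le_one (n : ℕ) (x : Torus) : |sinWave n x| ≤ 1 := by
  obtain ⟨y, rfl⟩ := QuotientAddGroup.mk_surjective x
  exact Real.abs_sin_le_one _

/-- Since `|sin| ≤ 1`, `|sin|` dominates `sin ^ 2`, whose integral is `π`. -/
theorem pi_le_integral_abs_sinWave {n : ℕ} (hn : n ≠ 0) : π ≤ ∫ x, |sinWave n x| := by
  have hn' : (n : ℝ) ≠ 0 := Nat.cast_ne_zero.2 hn
  have hsq : ∫ x, sinWave n x ^ 2 = π := by
    rw [← Torus.intervalIntegral_eq 0]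
    simp only [sinWave_coe, zero_add]
    rw [intervalIntegral.integral_comp_mul_left (fun x => Real.sin x ^ 2) hn', integral_sin_sq,
      mul_zero, Real.sin_zero, ← zero_add ((n : ℝ) * (2 * π)), Real.sin_add_nat_mul_two_pi,
      Real.sin_zero, smul_eq_mul]
    field_simp
    ring
  refine hsq.ge.trans (integral_mono (Torus.integrable_of_continuous ((continuous_sinWave n).pow 2))
    (Torus.integrable_of_continuous (continuous_sinWave n).abs) fun x => ?_)
  have := abs_sinWave_le_one n x
  have h0 := abs_nonneg (sinWave n x)
  change sinWave n x ^ 2 ≤ |sinWave n x|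
  rw [← sq_abs]
  nlinarith

/-- The left side is at most `2n * (1 / (2n)) = 1`; the right is at least 1, as the `L¹` norm is at
least `π` and the sup norm at most 1. -/
theorem numSolutions_mul_negSobolevNorm_sinWave_le {n : ℕ} (hn : n ≠ 0) :
    numSolutions (sinWave n) 0 * negSobolevNorm (sinWave n)
      ≤ eLpNorm (sinWave n) 1 volume ^ 2 / eLpNorm (sinWave n) ∞ volume := by
  have hn' : 0 < (n : ℝ) := by positivity
  calc numSolutions (sinWave n) 0 * negSobolevNorm (sinWave n)
      ≤ ENNReal.ofReal (2 * n) * ENNReal.ofReal (1 / (2 * n)) :=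
        mul_le_mul' (numSolutions_sinWave_le hn) (negSobolevNorm_sinWave hn).le
    _ = 1 := by
        rw [← ENNReal.ofReal_mul (by positivity), mul_one_div_cancel (by positivity),
          ENNReal.ofReal_one]
    _ ≤ eLpNorm (sinWave n) 1 volume ^ 2 := by
        refine one_le_pow_of_one_le' ?_ 2
        rw [eLpNorm_one_eq_ofReal (continuous_sinWave n), ENNReal.one_le_ofReal]
        linarith [pi_le_integral_abs_sinWave hn, pi_gt_three]
    _ = eLpNorm (sinWave n) 1 volume ^ 2 / 1 := (div_one _).symm
    _ ≤ eLpNorm (sinWave n) 1 volume ^ 2 / eLpNorm (sinWave n) ∞ volume := by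
        refine ENNReal.div_le_div_left ?_ _
        rw [eLpNorm_exponent_top]
        refine eLpNormEssSup_le_of_ae_enorm_bound (Filter.Eventually.of_forall fun x => ?_)
        rw [Real.enorm_eq_ofReal_abs, ENNReal.ofReal_le_one]
        exact abs_sinWave_le_one n x

/-! ### The uncertainty principle -/

/-- The almost everywhere bound holds on a dense closed set. The pointwise form is needed for `f +
‖f‖_∞` to be nonnegative everywhere. -/
theorem Torus.abs_le_of_continuous {g : Torus → ℝ} (hg : Continuous g) (x : Torus) :
    |g x| ≤ (eLpNorm g ∞ volume).toReal := by
  have hcl : IsClosed {x : Torus | |g x| ≤ (eLpNorm g ∞ volume).toReal} :=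
    isClosed_le hg.abs continuous_const
  have hd : Dense {x : Torus | |g x| ≤ (eLpNorm g ∞ volume).toReal} :=
    Measure.dense_of_ae (ae_abs_le hg)
  have := hd x
  rwa [hcl.closure_eq] at this

/-- Uncertainty principle: apply the two bounds on the Wasserstein distance to `f + ‖f‖_∞`. -/
theorem numSolutions_mul_negSobolevNorm_ge {f : Torus → ℝ} (hf : Continuous f)
    (hmean : meanValue f = 0) :
    ((1 / 192 : ℝ≥0) : ℝ≥0∞) * (eLpNorm f 1 volume ^ 2 / eLpNorm f ∞ volume)
      ≤ numSolutions f 0 * negSobolevNorm f := by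
  set M := (eLpNorm f ∞ volume).toReal with hM
  have hfin := (Torus.memLp_top_of_continuous hf).2
  have hg : Continuous fun x => f x + M := hf.add continuous_const
  have hbd := Torus.abs_le_of_continuous hf
  have hg0 : ∀ x, 0 ≤ f x + M := fun x => by linarith [(abs_le.1 (hbd x)).1]
  have hgm : meanValue (fun x => f x + M) = M := by
    rw [meanValue_eq, integral_add (Torus.integrable_of_continuous hf) (integrable_const _),
      integral_eq_meanValue, hmean, integral_const_torus, mul_zero, zero_add,
      inv_mul_cancel_left₀ two_pi_pos.ne']
  have h3 := numSolutions_mul_wasserstein_ge hg hg0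
  have h4 := wasserstein_le_negSobolevNorm hg hg0
  have hneg : negSobolevNorm (fun x => f x + M) = negSobolevNorm f := by
    unfold negSobolevNorm
    congr 2
    funext k
    rw [fourierCoeff_add_const hf M (by exact_mod_cast k.ne_zero)]
  have hnum : numSolutions (fun x => f x + M) M = numSolutions f 0 := by
    simp only [numSolutions, add_eq_right]
  have hsup : eLpNorm (fun x => f x + M) ∞ volume ≤ 2 * eLpNorm f ∞ volume := by
    rw [eLpNorm_exponent_top (f := fun x => f x + M)]
    refine eLpNormEssSup_le_of_ae_enorm_bound (Filter.Eventually.of_forall fun x => ?_)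
    rw [← ENNReal.ofReal_toReal hfin.ne, ← hM, ← ENNReal.ofReal_ofNat,
      ← ENNReal.ofReal_mul (by norm_num), Real.enorm_eq_ofReal_abs, abs_of_nonneg (hg0 x)]
    exact ENNReal.ofReal_le_ofReal (by linarith [(abs_le.1 (hbd x)).2])
  rw [hgm] at h3 h4
  rw [hneg] at h4
  rw [hnum] at h3
  simp only [add_sub_cancel_right] at h3
  set A := eLpNorm f 1 volume ^ 2
  set B := eLpNorm f ∞ volume
  set R := numSolutions f 0 * negSobolevNorm f with hR
  have h5 : ((1 / 8 : ℝ≥0) : ℝ≥0∞) * (A / (2 * B)) ≤ ((12 : ℝ≥0) : ℝ≥0∞) * R := by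
    refine (mul_le_mul_right (ENNReal.div_le_div_left hsup _) _).trans (h3.trans ?_)
    rw [hR, mul_left_comm]
    exact mul_le_mul_right h4 _
  -- The constant is `1/12` from the upper bound, `1/8` from the lower bound and `1/2` from the
  -- doubled sup norm.
  have h6 : ((1 / 192 : ℝ≥0) : ℝ≥0∞) * (A / B)
      = ((1 / 12 : ℝ≥0) : ℝ≥0∞) * (((1 / 8 : ℝ≥0) : ℝ≥0∞) * (A / (2 * B))) := by
    have h2 : A / (2 * B) = ((1 / 2 : ℝ≥0) : ℝ≥0∞) * (A / B) := by
      rw [one_div, ENNReal.coe_inv two_ne_zero, div_eq_mul_inv, div_eq_mul_inv,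
        ENNReal.mul_inv (by simp) (by simp), mul_left_comm]
      rfl
    rw [h2, ← mul_assoc, ← mul_assoc, ← ENNReal.coe_mul, ← ENNReal.coe_mul]
    norm_num
  rw [h6]
  refine (mul_le_mul_right h5 _).trans (le_of_eq ?_)
  rw [← mul_assoc, ← ENNReal.coe_mul]
  norm_num

theorem theorem4 :
    -- the uncertainty principle
    (∃ c : ℝ≥0, 0 < c ∧ ∀ f : Torus → ℝ, Continuous f → meanValue f = 0 →
      (c : ℝ≥0∞) * (eLpNorm f 1 volume ^ 2 / eLpNorm f ∞ volume)
        ≤ numSolutions f 0 * negSobolevNorm f) ∧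
    -- its sharpness, up to constants, for `sin(nx)`
    (∃ C : ℝ≥0, ∀ n : ℕ, 1 ≤ n →
      Continuous (sinWave n) ∧ meanValue (sinWave n) = 0 ∧ sinWave n ≠ 0 ∧
      numSolutions (sinWave n) 0 * negSobolevNorm (sinWave n)
        ≤ (C : ℝ≥0∞) * (eLpNorm (sinWave n) 1 volume ^ 2 / eLpNorm (sinWave n) ∞ volume)) ∧
    -- the stronger inequality with the Wasserstein distance
    (∃ c : ℝ≥0, 0 < c ∧ ∀ f : Torus → ℝ, Continuous f → (∀ x, 0 ≤ f x) →
      (c : ℝ≥0∞) *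
          (eLpNorm (fun x => f x - meanValue f) 1 volume ^ 2 / eLpNorm f ∞ volume)
        ≤ numSolutions f (meanValue f) *
          wasserstein 1 (densityMeasure f) (densityMeasure fun _ => meanValue f)) ∧
    -- the bound of the Wasserstein distance by the negative Sobolev norm
    (∃ C : ℝ≥0, ∀ f : Torus → ℝ, Continuous f → (∀ x, 0 ≤ f x) →
      wasserstein 1 (densityMeasure f) (densityMeasure fun _ => meanValue f)
        ≤ (C : ℝ≥0∞) * negSobolevNorm f) := by
  refine ⟨⟨1 / 192, by norm_num, fun f hf hm => numSolutions_mul_negSobolevNorm_ge hf hm⟩,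
    ⟨1, fun n hn => ?_⟩, ⟨1 / 8, by norm_num, fun f hf h0 => numSolutions_mul_wasserstein_ge hf h0⟩,
    ⟨12, fun f hf h0 => wasserstein_le_negSobolevNorm hf h0⟩⟩
  have hn0 : n ≠ 0 := Nat.one_le_iff_ne_zero.1 hn
  refine ⟨continuous_sinWave n, meanValue_sinWave hn0, sinWave_ne_zero hn0, ?_⟩
  rw [ENNReal.coe_one, one_mul]
  exact numSolutions_mul_negSobolevNorm_sinWave_le hn0
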